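/- Fix $d\in\mathbb N$. A \emph{coordinate system} on a complex Hilbert space $\mathcal H$ is a spectral measure $E$ on $\mathbb R^d$: a map from the Borel subsets of $\mathbb R^d$ to the orthogonal projections of $\mathcal H$ that is countably additive (in the strong operator topology) with $E(\mathbb R^d)=1$. For $\mathbf k\in\mathbb R^d$ put $v_E(\mathbf k)=\int_{\mathbb R^d} e^{i\mathbf x\cdot\mathbf k}\,dE(\mathbf x)$. If $E_1,E_2$ are coordinate systems on $\mathcal H_1,\mathcal H_2$, a bounded operator $W\colon\mathcal H_1\to\mathcal H_2$ is called \emph{smooth} (resp. \emph{uniform}) if the map $\mathbf k\mapsto v_{E_2}(\mathbf k)\,W\,v_{E_1}(-\mathbf k)$ from $\mathbb R^d$ to the bounded operators with the operator norm is $C^\infty$ (resp. continuous). A \emph{smooth $d$-dimensional discrete-time quantum walk} is a triple $(\mathcal H,(U^t)_{t\in\mathbb Z},E)$, where $E$ is a coordinate system on $\mathcal H$ and $U$ is a unitary operator on $\mathcal H$ such that $U^t$ is smooth (with respect to $E$ and $E$) for every $t\in\mathbb Z$. For $\xi\in\mathcal H$ and an integer $t\ge 1$ let $\nu_{U,t,\xi}$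 be the finite Borel measure on $\mathbb R^d$ given by $$\nu_{U,t,\xi}(\Omega)=\langle E(t\Omega)\,U^t\xi,\,U^t\xi\rangle .$$ Theorem. Let $(\mathcal H_1,(U_1^t)_{t\in\mathbb Z},E_1)$ and $(\mathcal H_2,(U_2^t)_{t\in\mathbb Z},E_2)$ be smooth $d$-dimensional discrete-time quantum walks, and let $V\colon\mathcal H_1\to\mathcal H_2$ be a unitary operator that is uniform (with respect to $E_1$ and $E_2$) and satisfies $VU_1=U_2V$. Then for every $\xi\in\mathcal H_1$: if the sequence $(\nu_{U_1,t,\xi})_t$ converges weakly as $t\to\infty$ (to some finite Borel measure, tested against bounded continuous functions), then the sequence $(\nu_{U_2,t,V\xi})_t$ also converges weakly. -/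

import Mathlib

open MeasureTheory Filter Topology
open scoped ENNReal NNReal InnerProductSpace ContDiff

noncomputable section

namespace QWalk

/-- A `d`-dimensional coordinate system of a complex Hilbert space `H`: a spectral measure on the
Borel subsets of `ℝ^d`. Countable additivity is in the strong operator topology. Only the values
of `proj` on Borel sets are meaningful. -/
structure CoordinateSystem (d : ℕ) (H : Type*) [NormedAddCommGroup H] [InnerProductSpace ℂ H]
    [CompleteSpace H] where
  /-- the projection `E(A)` attached to a Borel set `A` -/
  proj : Set (EuclideanSpace ℝ (Fin d)) → (H →L[ℂ] H)
  isStarProjection_proj : ∀ A, MeasurableSet A → IsStarProjection (proj A)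
  hasSum_proj : ∀ A : ℕ → Set (EuclideanSpace ℝ (Fin d)), (∀ n, MeasurableSet (A n)) →
    Pairwise (Function.onFun Disjoint A) →
    ∀ ξ : H, HasSum (fun n => proj (A n) ξ) (proj (⋃ n, A n) ξ)
  proj_univ : proj Set.univ = 1

namespace CoordinateSystem

variable {d : ℕ} {H : Type*} [NormedAddCommGroup H] [InnerProductSpace ℂ H] [CompleteSpace H]

theorem inner_proj (E : CoordinateSystem d H) (ξ : H) {A : Set (EuclideanSpace ℝ (Fin d))}
    (hA : MeasurableSet A) : ⟪ξ, E.proj A ξ⟫_ℂ = ((‖E.proj A ξ‖ ^ 2 : ℝ) : ℂ) := by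
  have h := E.isStarProjection_proj A hA
  have h1 : E.proj A (E.proj A ξ) = E.proj A ξ :=
    congrArg (fun T : H →L[ℂ] H => T ξ) h.isIdempotentElem.eq
  have h2 : ContinuousLinearMap.adjoint (E.proj A) = E.proj A := h.isSelfAdjoint
  calc ⟪ξ, E.proj A ξ⟫_ℂ = ⟪ξ, ContinuousLinearMap.adjoint (E.proj A) (E.proj A ξ)⟫_ℂ := by
        rw [h2, h1]
    _ = ⟪E.proj A ξ, E.proj A ξ⟫_ℂ := ContinuousLinearMap.adjoint_inner_right _ _ _
    _ = _ := by rw [inner_self_eq_norm_sq_to_K]; norm_cast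

theorem proj_empty (E : CoordinateSystem d H) (ξ : H) : E.proj ∅ ξ = 0 := by
  have h := E.hasSum_proj (fun _ => ∅) (fun _ => MeasurableSet.empty)
    (fun _ _ _ => disjoint_bot_left) ξ
  exact (summable_const_iff _).1 h.summable

/-- The position distribution `μ_ξ(A) = ⟨E(A) ξ, ξ⟩` of a vector `ξ`. -/
def dist (E : CoordinateSystem d H) (ξ : H) : Measure (EuclideanSpace ℝ (Fin d)) :=
  Measure.ofMeasurable (fun A _ => ENNReal.ofReal (RCLike.re ⟪ξ, E.proj A ξ⟫_ℂ))
    (by simp [E.proj_empty])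
    (by
      intro A hA hd
      have h := (E.hasSum_proj A hA hd ξ).mapL (innerSL ℂ ξ)
      have h' := Complex.hasSum_re h
      have hn : ∀ n, 0 ≤ (⟪ξ, E.proj (A n) ξ⟫_ℂ).re := fun n => by
        rw [E.inner_proj ξ (hA n), Complex.ofReal_re]; positivity
      have e := h'.tsum_eq
      simp only [innerSL_apply_apply] at e
      change ENNReal.ofReal (⟪ξ, E.proj (⋃ n, A n) ξ⟫_ℂ).re
        = ∑' n, ENNReal.ofReal (⟪ξ, E.proj (A n) ξ⟫_ℂ).re
      rw [← e]
      exact ENNReal.ofReal_tsum_of_nonneg hn h'.summable)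

theorem dist_apply (E : CoordinateSystem d H) (ξ : H) {A : Set (EuclideanSpace ℝ (Fin d))}
    (hA : MeasurableSet A) : E.dist ξ A = ENNReal.ofReal (RCLike.re ⟪ξ, E.proj A ξ⟫_ℂ) :=
  Measure.ofMeasurable_apply A hA

theorem dist_univ (E : CoordinateSystem d H) (ξ : H) :
    E.dist ξ Set.univ = ENNReal.ofReal (‖ξ‖ ^ 2) := by
  rw [E.dist_apply ξ MeasurableSet.univ, E.inner_proj ξ MeasurableSet.univ, E.proj_univ,
    RCLike.re_to_complex, Complex.ofReal_re]
  rfl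

instance (E : CoordinateSystem d H) (ξ : H) : IsFiniteMeasure (E.dist ξ) :=
  ⟨by rw [E.dist_univ]; exact ENNReal.ofReal_lt_top⟩

theorem real_dist (E : CoordinateSystem d H) (ξ : H) {A : Set (EuclideanSpace ℝ (Fin d))}
    (hA : MeasurableSet A) : (((E.dist ξ).real A : ℝ) : ℂ) = ⟪ξ, E.proj A ξ⟫_ℂ := by
  rw [measureReal_def, E.dist_apply ξ hA, E.inner_proj ξ hA, RCLike.re_to_complex,
    Complex.ofReal_re, ENNReal.toReal_ofReal (by positivity)]

/-- A linear relation between position distributions is inherited by integrals. -/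
theorem sum_integral_eq_zero (E : CoordinateSystem d H) (w : H →₀ ℂ)
    (hw : ∀ A, MeasurableSet A →
      Finsupp.linearCombination ℂ (fun ξ : H => ⟪ξ, E.proj A ξ⟫_ℂ) w = 0)
    {f : EuclideanSpace ℝ (Fin d) → ℂ} (hf : ∀ ξ, Integrable f (E.dist ξ)) :
    Finsupp.linearCombination ℂ (fun ξ : H => ∫ x, f x ∂(E.dist ξ)) w = 0 := by
  simp only [Finsupp.linearCombination_apply, Finsupp.sum] at hw ⊢
  set μ : Measure (EuclideanSpace ℝ (Fin d)) := ∑ ξ ∈ w.support, E.dist ξ with hμ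
  have hint : ∀ {g : EuclideanSpace ℝ (Fin d) → ℂ}, Integrable g μ →
      ∀ ξ ∈ w.support, Integrable g (E.dist ξ) := fun hg =>
    integrable_finsetSum_measure.1 hg
  have hle : ∀ ξ ∈ w.support, E.dist ξ ≤ μ := fun ξ hξ =>
    Finset.single_le_sum (f := fun ξ => E.dist ξ) (fun _ _ => Measure.zero_le _) hξ
  refine Integrable.induction (μ := μ)
    (P := fun g => ∑ ξ ∈ w.support, w ξ • ∫ x, g x ∂(E.dist ξ) = 0) ?_ ?_ ?_ ?_
    (integrable_finsetSum_measure.2 fun ξ _ => hf ξ)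
  · intro c A hA _
    have : ∀ ξ ∈ w.support, w ξ • ∫ x, A.indicator (fun _ => c) x ∂(E.dist ξ)
        = (w ξ • ⟪ξ, E.proj A ξ⟫_ℂ) * c := by
      intro ξ _
      rw [integral_indicator_const c hA, ← E.real_dist ξ hA, Complex.real_smul]
      simp only [smul_eq_mul]; ring
    rw [Finset.sum_congr rfl this, ← Finset.sum_mul, hw A hA, zero_mul]
  · intro g h _ hg hh h1 h2
    have : ∀ ξ ∈ w.support, w ξ • ∫ x, (g + h) x ∂(E.dist ξ)
        = w ξ • ∫ x, g x ∂(E.dist ξ) + w ξ • ∫ x, h x ∂(E.dist ξ) := by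
      intro ξ hξ
      rw [← smul_add, ← integral_add (hint hg ξ hξ) (hint hh ξ hξ)]; rfl
    rw [Finset.sum_congr rfl this, Finset.sum_add_distrib, h1, h2, add_zero]
  · refine isClosed_eq (continuous_finsetSum _ fun ξ hξ => ?_) continuous_const
    have hc := (LipschitzWith.of_dist_le_mul (K := 1)
      (f := fun g : Lp ℂ 1 μ => ∫ x, g x ∂(E.dist ξ)) ?_).continuous
    · exact (continuous_const (y := w ξ)).smul hc
    · intro g h
      have hg := (L1.integrable_coeFn g)
      have hh := (L1.integrable_coeFn h)
      rw [dist_eq_norm, dist_eq_norm, ← integral_sub (hint hg ξ hξ) (hint hh ξ hξ),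
        NNReal.coe_one, one_mul, L1.norm_eq_integral_norm]
      calc ‖∫ x, (g x - h x) ∂(E.dist ξ)‖ ≤ ∫ x, ‖g x - h x‖ ∂(E.dist ξ) :=
            norm_integral_le_integral_norm _
        _ ≤ ∫ x, ‖g x - h x‖ ∂μ :=
            integral_mono_measure (hle ξ hξ) (Eventually.of_forall fun _ => norm_nonneg _)
              (hg.sub hh).norm
        _ = ∫ x, ‖(g - h : Lp ℂ 1 μ) x‖ ∂μ := by
            refine integral_congr_ae ?_
            filter_upwards [Lp.coeFn_sub g h] with x hx
            rw [hx]; rfl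
  · intro g h hgh _ h1
    rw [← h1]
    refine Finset.sum_congr rfl fun ξ hξ => ?_
    rw [integral_congr_ae ((Measure.absolutelyContinuous_of_le (hle ξ hξ)).ae_le hgh)]

/-- The formal combination of vectors occurring in the polarization identity. -/
def polar {H : Type*} [NormedAddCommGroup H] [InnerProductSpace ℂ H] (ξ η : H) : H →₀ ℂ :=
  Finsupp.single (ξ + η) (1 / 4) - Finsupp.single (ξ - η) (1 / 4)
    - Finsupp.single (ξ + Complex.I • η) (Complex.I / 4)
    + Finsupp.single (ξ - Complex.I • η) (Complex.I / 4)

theorem linearCombination_polar {H : Type*} [NormedAddCommGroup H] [InnerProductSpace ℂ H]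
    (T : H →L[ℂ] H) (ξ η : H) :
    Finsupp.linearCombination ℂ (fun ζ : H => ⟪ζ, T ζ⟫_ℂ) (polar ξ η) = ⟪ξ, T η⟫_ℂ := by
  simp only [polar, map_add, map_sub, Finsupp.linearCombination_single, inner_add_left,
    inner_add_right, inner_sub_left, inner_sub_right, map_smul, inner_smul_left, inner_smul_right,
    smul_eq_mul, Complex.conj_I]
  ring_nf
  simp only [Complex.I_sq]
  ring

/-- For a bounded Borel function `f`, the operator `∫ f dE` exists and is unique; it is
characterized by `⟨(∫ f dE) ξ, ξ⟩ = ∫ f dμ_ξ` for all vectors `ξ`. -/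
theorem existsUnique_integral (E : CoordinateSystem d H) {f : EuclideanSpace ℝ (Fin d) → ℂ}
    (hf : Measurable f) {C : ℝ} (hC : ∀ x, ‖f x‖ ≤ C) :
    ∃! T : H →L[ℂ] H, ∀ ξ, ⟪ξ, T ξ⟫_ℂ = ∫ x, f x ∂(E.dist ξ) := by
  have hC0 : 0 ≤ C := (norm_nonneg _).trans (hC 0)
  have hint : ∀ ξ, Integrable f (E.dist ξ) := fun ξ =>
    Integrable.of_bound hf.aestronglyMeasurable C (Eventually.of_forall hC)
  set Q : H → ℂ := fun ξ => ∫ x, f x ∂(E.dist ξ) with hQ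
  have hQb : ∀ ξ, ‖Q ξ‖ ≤ C * ‖ξ‖ ^ 2 := by
    intro ξ
    refine (norm_integral_le_of_norm_le_const (Eventually.of_forall hC)).trans_eq ?_
    rw [measureReal_def, E.dist_univ, ENNReal.toReal_ofReal (by positivity)]
  set S : H → H → ℂ := fun ξ η => Finsupp.linearCombination ℂ Q (polar ξ η) with hS
  have hadd_r : ∀ ξ η η', S ξ (η + η') = S ξ η + S ξ η' := by
    intro ξ η η'
    have := E.sum_integral_eq_zero (polar ξ (η + η') - (polar ξ η + polar ξ η'))
      (fun A _ => by
        simp only [map_sub, map_add, linearCombination_polar, inner_add_right]; ring) hint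
    rw [map_sub, map_add] at this
    exact sub_eq_zero.1 this
  have hsmul_r : ∀ (c : ℂ) ξ η, S ξ (c • η) = c • S ξ η := by
    intro c ξ η
    have := E.sum_integral_eq_zero (polar ξ (c • η) - c • polar ξ η)
      (fun A _ => by
        simp only [map_sub, map_smul, linearCombination_polar, inner_smul_right, smul_eq_mul]
        ring) hint
    rw [map_sub, map_smul] at this
    exact sub_eq_zero.1 this
  have hadd_l : ∀ ξ ξ' η, S (ξ + ξ') η = S ξ η + S ξ' η := by
    intro ξ ξ' η
    have := E.sum_integral_eq_zero (polar (ξ + ξ') η - (polar ξ η + polar ξ' η))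
      (fun A _ => by
        simp only [map_sub, map_add, linearCombination_polar, inner_add_left]; ring) hint
    rw [map_sub, map_add] at this
    exact sub_eq_zero.1 this
  have hsmul_l : ∀ (c : ℂ) ξ η, S (c • ξ) η = (starRingEnd ℂ) c • S ξ η := by
    intro c ξ η
    have := E.sum_integral_eq_zero (polar (c • ξ) η - (starRingEnd ℂ) c • polar ξ η)
      (fun A _ => by
        simp only [map_sub, map_smul, linearCombination_polar, inner_smul_left, smul_eq_mul]
        ring) hint
    rw [map_sub, map_smul] at this
    exact sub_eq_zero.1 this
  have hdiag : ∀ ξ, S ξ ξ = Q ξ := by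
    intro ξ
    have := E.sum_integral_eq_zero (polar ξ ξ - Finsupp.single ξ 1)
      (fun A _ => by
        simp only [map_sub, linearCombination_polar, Finsupp.linearCombination_single, one_smul,
          sub_self]) hint
    rw [map_sub, Finsupp.linearCombination_single, one_smul] at this
    exact sub_eq_zero.1 this
  have hb1 : ∀ ξ η, ‖S ξ η‖ ≤ C * (‖ξ‖ ^ 2 + ‖η‖ ^ 2) := by
    intro ξ η
    have e : S ξ η = (1 / 4 : ℂ) * Q (ξ + η) - (1 / 4 : ℂ) * Q (ξ - η)
        - (Complex.I / 4) * Q (ξ + Complex.I • η) + (Complex.I / 4) * Q (ξ - Complex.I • η) := by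
      simp only [hS, polar, map_add, map_sub, Finsupp.linearCombination_single, smul_eq_mul]
    have p1 := parallelogram_law_with_norm ℂ ξ η
    have p2 := parallelogram_law_with_norm ℂ ξ (Complex.I • η)
    have hI : ‖Complex.I • η‖ = ‖η‖ := by rw [norm_smul, Complex.norm_I, one_mul]
    rw [hI] at p2
    have b1 := hQb (ξ + η)
    have b2 := hQb (ξ - η)
    have b3 := hQb (ξ + Complex.I • η)
    have b4 := hQb (ξ - Complex.I • η)
    have n4 : ‖(1 / 4 : ℂ)‖ = 1 / 4 := by norm_num
    have nI : ‖(Complex.I / 4 : ℂ)‖ = 1 / 4 := by rw [norm_div, Complex.norm_I]; norm_num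
    calc ‖S ξ η‖ ≤ 1 / 4 * ‖Q (ξ + η)‖ + 1 / 4 * ‖Q (ξ - η)‖ + 1 / 4 * ‖Q (ξ + Complex.I • η)‖
          + 1 / 4 * ‖Q (ξ - Complex.I • η)‖ := by
          rw [e]
          refine (norm_add_le _ _).trans (add_le_add ((norm_sub_le _ _).trans
            (add_le_add ((norm_sub_le _ _).trans (add_le_add ?_ ?_)) ?_)) ?_) <;>
          simp only [norm_mul, n4, nI, le_refl]
      _ ≤ 1 / 4 * (C * ‖ξ + η‖ ^ 2) + 1 / 4 * (C * ‖ξ - η‖ ^ 2)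
          + 1 / 4 * (C * ‖ξ + Complex.I • η‖ ^ 2) + 1 / 4 * (C * ‖ξ - Complex.I • η‖ ^ 2) := by
          gcongr
      _ = C * (‖ξ‖ ^ 2 + ‖η‖ ^ 2) := by linear_combination (C / 4) * p1 + (C / 4) * p2
  have hb : ∀ ξ η, ‖S ξ η‖ ≤ 2 * C * ‖ξ‖ * ‖η‖ := by
    intro ξ η
    rcases eq_or_ne ξ 0 with rfl | h1
    · have : S 0 η = 0 := by simpa using hsmul_l 0 0 η
      simp [this]
    rcases eq_or_ne η 0 with rfl | h2
    · have : S ξ 0 = 0 := by simpa using hsmul_r 0 ξ 0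
      simp [this]
    have n1 : (‖ξ‖ : ℝ) ≠ 0 := norm_ne_zero_iff.2 h1
    have n2 : (‖η‖ : ℝ) ≠ 0 := norm_ne_zero_iff.2 h2
    have c1 : ((‖ξ‖ : ℝ) : ℂ) ≠ 0 := by exact_mod_cast n1
    have c2 : ((‖η‖ : ℝ) : ℂ) ≠ 0 := by exact_mod_cast n2
    have key := hb1 (((‖ξ‖ : ℝ) : ℂ)⁻¹ • ξ) (((‖η‖ : ℝ) : ℂ)⁻¹ • η)
    rw [hsmul_l, hsmul_r] at key
    simp only [norm_smul, norm_inv, Complex.norm_real, norm_norm, RCLike.norm_conj] at key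
    rw [inv_mul_cancel₀ n1, inv_mul_cancel₀ n2] at key
    have p1 : 0 < ‖ξ‖ := norm_pos_iff.2 h1
    have p2 : 0 < ‖η‖ := norm_pos_iff.2 h2
    calc ‖S ξ η‖ = ‖ξ‖ * ‖η‖ * (‖ξ‖⁻¹ * (‖η‖⁻¹ * ‖S ξ η‖)) := by field_simp
      _ ≤ ‖ξ‖ * ‖η‖ * (C * (1 ^ 2 + 1 ^ 2)) := by gcongr
      _ = _ := by ring
  set B : H →L⋆[ℂ] H →L[ℂ] ℂ :=
    LinearMap.mkContinuous₂ (LinearMap.mk₂'ₛₗ (starRingEnd ℂ) (RingHom.id ℂ) S hadd_l hsmul_l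
      hadd_r hsmul_r) (2 * C) hb with hB
  refine ⟨ContinuousLinearMap.adjoint (InnerProductSpace.continuousLinearMapOfBilin B),
    fun ξ => ?_, fun T hT => ?_⟩
  · rw [ContinuousLinearMap.adjoint_inner_right,
      InnerProductSpace.continuousLinearMapOfBilin_apply]
    exact hdiag ξ
  · have hT' : ∀ ξ η, ⟪ξ, T η⟫_ℂ = S ξ η := by
      intro ξ η
      rw [← linearCombination_polar T ξ η]
      simp only [hS]
      congr 2
      exact funext hT
    ext η
    refine ext_inner_left ℂ fun ξ => ?_
    rw [hT', ContinuousLinearMap.adjoint_inner_right,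
      InnerProductSpace.continuousLinearMapOfBilin_apply]
    rfl

theorem existsUnique_rep (E : CoordinateSystem d H) (k : EuclideanSpace ℝ (Fin d)) :
    ∃! T : H →L[ℂ] H, ∀ ξ, ⟪ξ, T ξ⟫_ℂ =
      ∫ x, Complex.exp (((inner ℝ x k : ℝ) : ℂ) * Complex.I) ∂(E.dist ξ) :=
  E.existsUnique_integral (C := 1) (by fun_prop)
    (fun _ => (Complex.norm_exp_ofReal_mul_I _).le)

/-- The operator `v_E(k) = ∫ exp(i x·k) dE(x)`. -/
def rep (E : CoordinateSystem d H) (k : EuclideanSpace ℝ (Fin d)) : H →L[ℂ] H :=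
  (E.existsUnique_rep k).choose

theorem inner_rep (E : CoordinateSystem d H) (k : EuclideanSpace ℝ (Fin d)) (ξ : H) :
    ⟪ξ, E.rep k ξ⟫_ℂ =
      ∫ x, Complex.exp (((inner ℝ x k : ℝ) : ℂ) * Complex.I) ∂(E.dist ξ) :=
  (E.existsUnique_rep k).choose_spec.1 ξ

end CoordinateSystem

section Morphisms

variable {d : ℕ} {H₁ H₂ : Type*}
  [NormedAddCommGroup H₁] [InnerProductSpace ℂ H₁] [CompleteSpace H₁]
  [NormedAddCommGroup H₂] [InnerProductSpace ℂ H₂] [CompleteSpace H₂]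

/-- `W_k = v₂(k) W v₁(-k)`. -/
def conjRep (E₁ : CoordinateSystem d H₁) (E₂ : CoordinateSystem d H₂) (W : H₁ →L[ℂ] H₂)
    (k : EuclideanSpace ℝ (Fin d)) : H₁ →L[ℂ] H₂ :=
  E₂.rep k ∘L W ∘L E₁.rep (-k)

/-- `W` is smooth: `k ↦ W_k` is a `C^∞` map into the bounded operators with the operator norm. -/
def IsSmoothMorphism (E₁ : CoordinateSystem d H₁) (E₂ : CoordinateSystem d H₂)
    (W : H₁ →L[ℂ] H₂) : Prop :=
  ContDiff ℝ ∞ (conjRep E₁ E₂ W)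

/-- `W` is uniform: `k ↦ W_k` is continuous for the operator norm. -/
def IsUniformMorphism (E₁ : CoordinateSystem d H₁) (E₂ : CoordinateSystem d H₂)
    (W : H₁ →L[ℂ] H₂) : Prop :=
  Continuous (conjRep E₁ E₂ W)

end Morphisms

/-- A `d`-dimensional discrete-time quantum walk on `H`: a coordinate system and a unitary
representation `t ↦ U ^ t` of `ℤ`, given by its generator `U`. -/
structure QuantumWalk (d : ℕ) (H : Type*) [NormedAddCommGroup H] [InnerProductSpace ℂ H]
    [CompleteSpace H] where
  /-- the coordinate system -/
  coord : CoordinateSystem d H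
  /-- the one-step time evolution -/
  U : unitary (H →L[ℂ] H)

namespace QuantumWalk

variable {d : ℕ} {H H₁ H₂ : Type*}
  [NormedAddCommGroup H] [InnerProductSpace ℂ H] [CompleteSpace H]
  [NormedAddCommGroup H₁] [InnerProductSpace ℂ H₁] [CompleteSpace H₁]
  [NormedAddCommGroup H₂] [InnerProductSpace ℂ H₂] [CompleteSpace H₂]

/-- The time evolution `U^t` as a bounded operator. -/
def evolution (Q : QuantumWalk d H) (t : ℤ) : H →L[ℂ] H := ((Q.U ^ t : unitary (H →L[ℂ] H)) : _)

/-- The walk is smooth: every `U^t` is a smooth morphism. -/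
def IsSmooth (Q : QuantumWalk d H) : Prop :=
  ∀ t : ℤ, IsSmoothMorphism Q.coord Q.coord (Q.evolution t)

/-- `T U₁ = U₂ T`. -/
def IsIntertwiner (Q₁ : QuantumWalk d H₁) (Q₂ : QuantumWalk d H₂) (T : H₁ →L[ℂ] H₂) : Prop :=
  T ∘L (Q₁.U : H₁ →L[ℂ] H₁) = (Q₂.U : H₂ →L[ℂ] H₂) ∘L T

/-- The velocity distribution `ν_{U,t,ξ}`: the push-forward of the position distribution of `U^t ξ`
along `x ↦ x / t`. (For `t = 0` this is a point mass at the origin, which is irrelevant for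
limits in `t`.) -/
def velocityDist (Q : QuantumWalk d H) (t : ℕ) (ξ : H) :
    FiniteMeasure (EuclideanSpace ℝ (Fin d)) :=
  ⟨(Q.coord.dist (Q.evolution t ξ)).map (fun x => (t : ℝ)⁻¹ • x), inferInstance⟩

end QuantumWalk

/-- A sequence of finite Borel measures converges weakly (to some finite Borel measure). The
topology on `FiniteMeasure` is that of integration of bounded continuous functions. -/
def WeaklyConverges {X : Type*} [TopologicalSpace X] [MeasurableSpace X] [OpensMeasurableSpace X]
    (ν : ℕ → FiniteMeasure X) : Prop :=
  ∃ ν' : FiniteMeasure X, Tendsto ν atTop (𝓝 ν')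

end QWalk

end

/-! Weak convergence is tested on characteristic functions. The velocity distribution at time `t`
has at `k` the characteristic function ⟨η, v(k/t) η⟩, where η is the evolved vector. With W_k =
v₂(k) V v₁(-k) one has v₂(k) V = W_k v₁(k). If η = U₁^t ξ, the intertwining relation makes V η the
evolved vector of the second walk, so its characteristic function at `k` is ⟨V η, W_{k/t} v₁(k/t)
η⟩, while unitarity of V turns that of the first walk into ⟨V η, V v₁(k/t) η⟩. They differ by at
most ‖W_{k/t} - V‖ ‖ξ‖², which tends to 0 because V is uniform and W_0 = V. Lévy's theorem then
gives convergence to the same limit measure.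

The argument is carried by `norm_charFun_dist_sub_le` and
`tendsto_finiteMeasure_of_tendsto_charFun`. It needs v(-k) v(k) = 1 and v(k)* = v(-k), which come
from multiplicativity of the spectral integral, `IsSpectralIntegral.mul`. -/

namespace QWalk

/-- Lévy's convergence theorem for finite measures. -/
theorem tendsto_finiteMeasure_of_tendsto_charFun {E : Type*} [NormedAddCommGroup E]
    [InnerProductSpace ℝ E] [FiniteDimensional ℝ E] [MeasurableSpace E] [BorelSpace E]
    {μ : ℕ → FiniteMeasure E} {ν : FiniteMeasure E}
    (h : ∀ k : E, Tendsto (fun n => charFun (μ n : Measure E) k) atTop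
      (𝓝 (charFun (ν : Measure E) k))) :
    Tendsto μ atTop (𝓝 ν) := by
  have hmass_eq : ∀ κ : FiniteMeasure E, (κ : Measure E).real Set.univ = κ.mass := fun _ => rfl
  -- The total mass is the characteristic function at 0.
  have hm : Tendsto (fun n => (μ n).mass) atTop (𝓝 ν.mass) := by
    have h0 := Complex.continuous_re.continuousAt.tendsto.comp (h 0)
    simp only [charFun_zero, Function.comp_def, Complex.ofReal_re, hmass_eq] at h0
    exact NNReal.tendsto_coe.1 h0
  -- Away from a zero limit, both sides can be normalized and Lévy's theorem for probability
  -- measures applies; the masses are then nonzero only eventually, hence `Tendsto.congr'` below.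
  rcases eq_or_ne ν 0 with rfl | hν
  · exact FiniteMeasure.tendsto_zero_of_tendsto_zero_mass (by simpa using hm)
  have hν' : ν.mass ≠ 0 := (FiniteMeasure.mass_nonzero_iff ν).2 hν
  refine (FiniteMeasure.tendsto_normalize_iff_tendsto hν).1
    ⟨ProbabilityMeasure.tendsto_of_tendsto_charFun fun k => ?_, hm⟩
  have hc : ∀ κ : FiniteMeasure E, κ.mass ≠ 0 → charFun (κ.normalize : Measure E) k
      = (((κ.mass : ℝ) : ℂ))⁻¹ * charFun (κ : Measure E) k := by
    intro κ hκ
    rw [FiniteMeasure.toMeasure_normalize_eq_of_nonzero _ ((FiniteMeasure.mass_nonzero_iff κ).1 hκ)]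
    simp only [charFun_apply]
    rw [integral_smul_nnreal_measure, NNReal.smul_def, Complex.real_smul]
    simp
  rw [hc ν hν']
  refine Tendsto.congr' (f₁ := fun n => (((μ n).mass : ℝ) : ℂ)⁻¹ * charFun (μ n : Measure E) k)
    ?_ ?_
  · filter_upwards [hm.eventually_ne hν'] with n hn using (hc _ hn).symm
  · refine Tendsto.mul (Tendsto.inv₀ ?_ (by exact_mod_cast hν')) (h k)
    exact (Complex.continuous_ofReal.tendsto _).comp (NNReal.tendsto_coe.2 hm)

/-! ### Multiplicative functional calculus of a spectral measure -/

namespace CoordinateSystem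

variable {d : ℕ} {H : Type*} [NormedAddCommGroup H] [InnerProductSpace ℂ H] [CompleteSpace H]

/-- Polarization over ℂ: the quadratic form determines the operator. -/
theorem clm_ext_inner {H : Type*} [NormedAddCommGroup H] [InnerProductSpace ℂ H]
    {S T : H →L[ℂ] H} (h : ∀ ξ, ⟪ξ, S ξ⟫_ℂ = ⟪ξ, T ξ⟫_ℂ) : S = T := by
  refine ContinuousLinearMap.coe_injective ((ext_inner_map _ _).1 fun ξ => ?_)
  have := congrArg (starRingEnd ℂ) (h ξ)
  rwa [inner_conj_symm, inner_conj_symm] at this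

/-- The bounded operator `T` is the integral `∫ f dE`. -/
def IsSpectralIntegral (E : CoordinateSystem d H) (f : EuclideanSpace ℝ (Fin d) → ℂ)
    (T : H →L[ℂ] H) : Prop :=
  ∀ ξ, ⟪ξ, T ξ⟫_ℂ = ∫ x, f x ∂(E.dist ξ)

variable {E : CoordinateSystem d H} {f g : EuclideanSpace ℝ (Fin d) → ℂ} {S T : H →L[ℂ] H}

theorem IsSpectralIntegral.unique (hS : E.IsSpectralIntegral f S) (hT : E.IsSpectralIntegral f T) :
    S = T :=
  clm_ext_inner fun ξ => (hS ξ).trans (hT ξ).symm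

theorem IsSpectralIntegral.adjoint (hT : E.IsSpectralIntegral f T) :
    E.IsSpectralIntegral (fun x => starRingEnd ℂ (f x)) (ContinuousLinearMap.adjoint T) := by
  intro ξ
  rw [ContinuousLinearMap.adjoint_inner_right, ← inner_conj_symm, hT ξ, integral_conj]

theorem isSpectralIntegral_indicator (E : CoordinateSystem d H) (c : ℂ)
    {A : Set (EuclideanSpace ℝ (Fin d))} (hA : MeasurableSet A) :
    E.IsSpectralIntegral (A.indicator fun _ => c) (c • E.proj A) := by
  intro ξ
  rw [integral_indicator_const c hA, Complex.real_smul, E.real_dist ξ hA, mul_comm]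
  exact inner_smul_right _ _ _

theorem isSpectralIntegral_one (E : CoordinateSystem d H) :
    E.IsSpectralIntegral (fun _ => 1) 1 := by
  have h := E.isSpectralIntegral_indicator 1 MeasurableSet.univ
  rwa [E.proj_univ, one_smul, Set.indicator_univ] at h

theorem isSpectralIntegral_rep (E : CoordinateSystem d H) (k : EuclideanSpace ℝ (Fin d)) :
    E.IsSpectralIntegral (fun x => Complex.exp (((inner ℝ x k : ℝ) : ℂ) * Complex.I)) (E.rep k) :=
  E.inner_rep k

theorem proj_union (E : CoordinateSystem d H) {A B : Set (EuclideanSpace ℝ (Fin d))}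
    (hA : MeasurableSet A) (hB : MeasurableSet B) (hAB : Disjoint A B) :
    E.proj (A ∪ B) = E.proj A + E.proj B := by
  refine clm_ext_inner fun ξ => ?_
  rw [add_apply, inner_add_right, ← E.real_dist ξ hA, ← E.real_dist ξ hB,
    ← E.real_dist ξ (hA.union hB), measureReal_union hAB hB, Complex.ofReal_add]

/-- A sum p + q of idempotents is idempotent only if pq + qp = 0. Multiplying by p on either side
gives pq = qp, so 2pq = 0. -/
theorem proj_mul_proj_of_disjoint (E : CoordinateSystem d H)
    {A B : Set (EuclideanSpace ℝ (Fin d))} (hA : MeasurableSet A) (hB : MeasurableSet B)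
    (hAB : Disjoint A B) : E.proj A * E.proj B = 0 := by
  have hA' := (E.isStarProjection_proj A hA).isIdempotentElem
  have hB' := (E.isStarProjection_proj B hB).isIdempotentElem
  have h := (E.isStarProjection_proj _ (hA.union hB)).isIdempotentElem
  rw [E.proj_union hA hB hAB] at h
  have : IsAddTorsionFree (H →L[ℂ] H) := .of_isTorsionFree ℂ _
  exact hA'.mul_eq_zero_of_anticommute ((hA'.add_iff hB').1 h)

theorem proj_mul_proj (E : CoordinateSystem d H) {A B : Set (EuclideanSpace ℝ (Fin d))}
    (hA : MeasurableSet A) (hB : MeasurableSet B) : E.proj A * E.proj B = E.proj (A ∩ B) := by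
  have hI := hA.inter hB
  have e1 : E.proj A = E.proj (A ∩ B) + E.proj (A \ B) := by
    rw [← E.proj_union hI (hA.diff hB) Set.disjoint_sdiff_inter.symm, Set.inter_union_sdiff]
  have e2 : E.proj B = E.proj (A ∩ B) + E.proj (B \ A) := by
    rw [Set.inter_comm, ← E.proj_union (hB.inter hA) (hB.diff hA) Set.disjoint_sdiff_inter.symm,
      Set.inter_union_sdiff]
  rw [e1, e2, add_mul, mul_add, mul_add, (E.isStarProjection_proj _ hI).isIdempotentElem.eq,
    E.proj_mul_proj_of_disjoint hI (hB.diff hA)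
      (Set.disjoint_sdiff_right.mono_left Set.inter_subset_left),
    E.proj_mul_proj_of_disjoint (hA.diff hB) hI
      (Set.disjoint_sdiff_left.mono_right Set.inter_subset_right),
    E.proj_mul_proj_of_disjoint (hA.diff hB) (hB.diff hA)
      (Set.disjoint_sdiff_right.mono_left Set.sdiff_subset)]
  simp

theorem integrable_of_bounded (E : CoordinateSystem d H) (hf : Measurable f) {C : ℝ}
    (hC : ∀ x, ‖f x‖ ≤ C) (ξ : H) : Integrable f (E.dist ξ) :=
  Integrable.of_bound hf.aestronglyMeasurable C (Eventually.of_forall hC)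

/-- Off-diagonal matrix entries become finite combinations of integrals against positive measures,
so dominated convergence applies to them. -/
theorem inner_eq_linearCombination_polar (hT : E.IsSpectralIntegral f T) (ξ η : H) :
    ⟪ξ, T η⟫_ℂ =
      Finsupp.linearCombination ℂ (fun ζ : H => ∫ x, f x ∂(E.dist ζ)) (polar ξ η) := by
  rw [← linearCombination_polar T ξ η]
  congr 2
  exact funext hT

/-- Bounded pointwise convergence of functions gives weak convergence of their integrals. -/
theorem tendsto_inner_of_tendsto {F : ℕ → EuclideanSpace ℝ (Fin d) → ℂ} {R : ℕ → H →L[ℂ] H}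
    (hF : ∀ n, Measurable (F n)) {C : ℝ} (hC : ∀ n x, ‖F n x‖ ≤ C)
    (hlim : ∀ x, Tendsto (fun n => F n x) atTop (𝓝 (f x)))
    (hR : ∀ n, E.IsSpectralIntegral (F n) (R n)) (hT : E.IsSpectralIntegral f T) (ξ η : H) :
    Tendsto (fun n => ⟪ξ, R n η⟫_ℂ) atTop (𝓝 ⟪ξ, T η⟫_ℂ) := by
  simp only [inner_eq_linearCombination_polar (hR _), inner_eq_linearCombination_polar hT,
    Finsupp.linearCombination_apply, Finsupp.sum]
  refine tendsto_finsetSum _ fun ζ _ => Tendsto.const_smul ?_ _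
  exact tendsto_integral_of_dominated_convergence (fun _ => C)
    (fun n => (hF n).aestronglyMeasurable) (integrable_const _)
    (fun n => Eventually.of_forall (hC n)) (Eventually.of_forall hlim)

/-- If `(∫ g dE) T = ∫ g f dE` holds for indicator functions `g`, it holds for all bounded Borel
functions `g`. -/
theorem IsSpectralIntegral.comp_of_proj (hf : Measurable f) {C : ℝ} (hC : ∀ x, ‖f x‖ ≤ C)
    (h : ∀ A, MeasurableSet A →
      E.IsSpectralIntegral (fun x => A.indicator (fun _ => 1) x * f x) (E.proj A * T))
    (hg : Measurable g) {D : ℝ} (hD : ∀ x, ‖g x‖ ≤ D) (hS : E.IsSpectralIntegral g S) :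
    E.IsSpectralIntegral (fun x => g x * f x) (S * T) := by
  have hD0 : 0 ≤ D := (norm_nonneg _).trans (hD 0)
  -- For simple functions the operator is an explicit combination of projections; the general case
  -- follows by bounded approximation.
  have simple : ∀ s : SimpleFunc (EuclideanSpace ℝ (Fin d)) ℂ,
      ∃ R : H →L[ℂ] H, E.IsSpectralIntegral s R ∧
        E.IsSpectralIntegral (fun x => s x * f x) (R * T) := by
    intro s
    induction s using SimpleFunc.induction with
    | const c hA =>
      rename_i A
      have e : ⇑(SimpleFunc.piecewise A hA (SimpleFunc.const _ c) (SimpleFunc.const _ 0))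
          = A.indicator fun _ => c := by
        classical
        ext x; simp [Set.indicator_apply, Set.piecewise]
      refine ⟨c • E.proj A, by rw [e]; exact E.isSpectralIntegral_indicator c hA, fun ξ => ?_⟩
      rw [e, smul_mul_assoc, smul_apply, inner_smul_right, h A hA ξ,
        ← integral_const_mul]
      congr 1 with x
      by_cases hx : x ∈ A <;> simp [hx]
    | add hd h1 h2 =>
      rename_i s t
      obtain ⟨R₁, a₁, b₁⟩ := h1
      obtain ⟨R₂, a₂, b₂⟩ := h2
      obtain ⟨M, hM⟩ := s.exists_forall_norm_le
      obtain ⟨N, hN⟩ := t.exists_forall_norm_le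
      have bdf : ∀ {s : SimpleFunc (EuclideanSpace ℝ (Fin d)) ℂ} {M : ℝ}, (∀ x, ‖s x‖ ≤ M) →
          ∀ x, ‖s x * f x‖ ≤ M * C := fun hM x => by
        rw [norm_mul]
        exact mul_le_mul (hM x) (hC x) (norm_nonneg _) ((norm_nonneg _).trans (hM x))
      refine ⟨R₁ + R₂, fun ξ => ?_, fun ξ => ?_⟩
      · rw [add_apply, inner_add_right, a₁, a₂,
          ← integral_add (E.integrable_of_bounded s.measurable hM ξ)
            (E.integrable_of_bounded t.measurable hN ξ)]
        rfl
      · rw [add_mul, add_apply, inner_add_right, b₁, b₂,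
          ← integral_add (f := fun x => s x * f x) (g := fun x => t x * f x)
            (E.integrable_of_bounded (s.measurable.mul hf) (bdf hM) ξ)
            (E.integrable_of_bounded (t.measurable.mul hf) (bdf hN) ξ)]
        simp only [SimpleFunc.coe_add, Pi.add_apply, add_mul]
  choose R hR hRT using simple
  have hgs := hg.stronglyMeasurable
  set G := hgs.approxBounded D with hG
  have hGb : ∀ n x, ‖G n x‖ ≤ D := hgs.norm_approxBounded_le hD0
  have hGl : ∀ x, Tendsto (fun n => G n x) atTop (𝓝 (g x)) := fun x =>
    hgs.tendsto_approxBounded_of_norm_le (hD x)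
  intro ξ
  -- The diagonal entry of `S * T` at `ξ` is the entry of `S` at the pair `ξ`, `T ξ`, so weak
  -- convergence suffices.
  have l1 := tendsto_inner_of_tendsto (fun n => (G n).measurable) hGb hGl (fun n => hR (G n)) hS
    ξ (T ξ)
  have l2 : Tendsto (fun n => ∫ x, G n x * f x ∂(E.dist ξ)) atTop
      (𝓝 (∫ x, g x * f x ∂(E.dist ξ))) :=
    tendsto_integral_of_dominated_convergence (fun _ => D * C)
      (fun n => ((G n).measurable.mul hf).aestronglyMeasurable) (integrable_const _)
      (fun n => Eventually.of_forall fun x => by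
        rw [norm_mul]; exact mul_le_mul (hGb n x) (hC x) (norm_nonneg _) hD0)
      (Eventually.of_forall fun x => (hGl x).mul_const _)
  refine tendsto_nhds_unique l1 (l2.congr fun n => ?_)
  exact (hRT (G n) ξ).symm

/-- The spectral integral of bounded Borel functions is multiplicative. -/
theorem IsSpectralIntegral.mul (hf : Measurable f) {C : ℝ} (hC : ∀ x, ‖f x‖ ≤ C)
    (hT : E.IsSpectralIntegral f T) (hg : Measurable g) {D : ℝ} (hD : ∀ x, ‖g x‖ ≤ D)
    (hS : E.IsSpectralIntegral g S) : E.IsSpectralIntegral (fun x => g x * f x) (S * T) := by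
  refine comp_of_proj hf hC (fun A hA => ?_) hg hD hS
  have hind : ∀ x, ‖A.indicator (fun _ => (1 : ℂ)) x‖ ≤ 1 := fun x => by
    by_cases hx : x ∈ A <;> simp [hx]
  have hadj : ContinuousLinearMap.adjoint (E.proj A) = E.proj A :=
    (E.isStarProjection_proj A hA).isSelfAdjoint
  -- `comp_of_proj` extends only the left factor. Taking adjoints turns E(A) T into T* E(A), where
  -- the indicator is on the right and the conjugate of `f` on the left; the remaining base case is
  -- E(B) E(A) = E(B ∩ A).
  have h := comp_of_proj (T := E.proj A) (measurable_const.indicator hA) hind (fun B hB => ?_)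
    (RCLike.continuous_conj.measurable.comp hf) (fun x => (RCLike.norm_conj (f x)).trans_le (hC x)) hT.adjoint
  · have h' := h.adjoint
    have e : ContinuousLinearMap.adjoint (ContinuousLinearMap.adjoint T * E.proj A)
        = E.proj A * T := by
      rw [ContinuousLinearMap.mul_def, ContinuousLinearMap.adjoint_comp, hadj,
        ContinuousLinearMap.adjoint_adjoint]
      rfl
    rw [e] at h'
    convert h' using 2 with x
    by_cases hx : x ∈ A <;> simp [hx]
  · have h' := E.isSpectralIntegral_indicator 1 (hB.inter hA)
    rw [one_smul, ← E.proj_mul_proj hB hA] at h'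
    convert h' using 2 with x
    by_cases hx : x ∈ A <;> by_cases hx' : x ∈ B <;> simp [hx, hx']

theorem rep_zero (E : CoordinateSystem d H) : E.rep 0 = 1 := by
  refine IsSpectralIntegral.unique (E.isSpectralIntegral_rep 0) ?_
  simpa using E.isSpectralIntegral_one

theorem rep_neg_mul_rep (E : CoordinateSystem d H) (k : EuclideanSpace ℝ (Fin d)) :
    E.rep (-k) * E.rep k = 1 := by
  have hb : ∀ k x : EuclideanSpace ℝ (Fin d),
      ‖Complex.exp (((inner ℝ x k : ℝ) : ℂ) * Complex.I)‖ ≤ 1 := fun k x =>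
    (Complex.norm_exp_ofReal_mul_I _).le
  have h := IsSpectralIntegral.mul (by fun_prop) (hb k) (E.isSpectralIntegral_rep k)
    (by fun_prop) (hb (-k)) (E.isSpectralIntegral_rep (-k))
  refine h.unique ?_
  convert E.isSpectralIntegral_one using 2 with x
  rw [← Complex.exp_add]
  simp

theorem adjoint_rep (E : CoordinateSystem d H) (k : EuclideanSpace ℝ (Fin d)) :
    ContinuousLinearMap.adjoint (E.rep k) = E.rep (-k) := by
  refine (E.isSpectralIntegral_rep k).adjoint.unique ?_
  convert E.isSpectralIntegral_rep (-k) using 2 with x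
  rw [← Complex.exp_conj]
  simp

theorem norm_rep_apply (E : CoordinateSystem d H) (k : EuclideanSpace ℝ (Fin d)) (ξ : H) :
    ‖E.rep k ξ‖ = ‖ξ‖ := by
  have h : ⟪E.rep k ξ, E.rep k ξ⟫_ℂ = ⟪ξ, ξ⟫_ℂ := by
    rw [← ContinuousLinearMap.adjoint_inner_right, E.adjoint_rep,
      ← mul_apply_eq_comp, E.rep_neg_mul_rep]
    rfl
  rw [@norm_eq_sqrt_re_inner ℂ, h, ← @norm_eq_sqrt_re_inner ℂ]

theorem charFun_dist (E : CoordinateSystem d H) (k : EuclideanSpace ℝ (Fin d)) (ξ : H) :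
    charFun (E.dist ξ) k = ⟪ξ, E.rep k ξ⟫_ℂ :=
  (E.inner_rep k ξ).symm

end CoordinateSystem

/-! ### Comparison of characteristic functions under a unitary -/

section Morphisms

variable {d : ℕ} {H₁ H₂ : Type*}
  [NormedAddCommGroup H₁] [InnerProductSpace ℂ H₁] [CompleteSpace H₁]
  [NormedAddCommGroup H₂] [InnerProductSpace ℂ H₂] [CompleteSpace H₂]

theorem conjRep_zero (E₁ : CoordinateSystem d H₁) (E₂ : CoordinateSystem d H₂)
    (W : H₁ →L[ℂ] H₂) : conjRep E₁ E₂ W 0 = W := by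
  ext ξ
  simp [conjRep, CoordinateSystem.rep_zero]

theorem conjRep_apply_rep (E₁ : CoordinateSystem d H₁) (E₂ : CoordinateSystem d H₂)
    (W : H₁ →L[ℂ] H₂) (k : EuclideanSpace ℝ (Fin d)) (ξ : H₁) :
    conjRep E₁ E₂ W k (E₁.rep k ξ) = E₂.rep k (W ξ) := by
  have h : E₁.rep (-k) (E₁.rep k ξ) = ξ :=
    congrArg (fun T : H₁ →L[ℂ] H₁ => T ξ) (E₁.rep_neg_mul_rep k)
  simp [conjRep, h]

/-- Characteristic functions of position distributions are nearly preserved by a unitary `V`. -/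
theorem norm_charFun_dist_sub_le (E₁ : CoordinateSystem d H₁) (E₂ : CoordinateSystem d H₂)
    (V : H₁ ≃ₗᵢ[ℂ] H₂) (k : EuclideanSpace ℝ (Fin d)) (ξ : H₁) :
    ‖charFun (E₂.dist (V ξ)) k - charFun (E₁.dist ξ) k‖ ≤
      ‖conjRep E₁ E₂ (V.toContinuousLinearEquiv : H₁ →L[ℂ] H₂) k
        - (V.toContinuousLinearEquiv : H₁ →L[ℂ] H₂)‖ * ‖ξ‖ ^ 2 := by
  set W : H₁ →L[ℂ] H₂ := (V.toContinuousLinearEquiv : H₁ →L[ℂ] H₂) with hW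
  have hWV : ∀ η, W η = V η := fun _ => rfl
  -- Unitarity of `V` rewrites ⟨ξ, v₁(k) ξ⟩ as ⟨V ξ, V v₁(k) ξ⟩, so both terms share the left vector
  -- V ξ.
  have e : charFun (E₂.dist (V ξ)) k - charFun (E₁.dist ξ) k
      = ⟪V ξ, (conjRep E₁ E₂ W k - W) (E₁.rep k ξ)⟫_ℂ := by
    rw [E₂.charFun_dist, E₁.charFun_dist, ← V.inner_map_map ξ, sub_apply,
      conjRep_apply_rep, inner_sub_right, hWV, hWV]
  rw [e]
  calc _ ≤ ‖V ξ‖ * ‖(conjRep E₁ E₂ W k - W) (E₁.rep k ξ)‖ := norm_inner_le_norm _ _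
    _ ≤ ‖V ξ‖ * (‖conjRep E₁ E₂ W k - W‖ * ‖E₁.rep k ξ‖) := by
      gcongr
      exact ContinuousLinearMap.le_opNorm _ _
    _ = _ := by rw [V.norm_map, E₁.norm_rep_apply]; ring

end Morphisms

/-! ### Time evolution and rescaled distributions -/

namespace QuantumWalk

variable {d : ℕ} {H H₁ H₂ : Type*}
  [NormedAddCommGroup H] [InnerProductSpace ℂ H] [CompleteSpace H]
  [NormedAddCommGroup H₁] [InnerProductSpace ℂ H₁] [CompleteSpace H₁]
  [NormedAddCommGroup H₂] [InnerProductSpace ℂ H₂] [CompleteSpace H₂]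

theorem evolution_natCast (Q : QuantumWalk d H) (t : ℕ) :
    Q.evolution t = (Q.U : H →L[ℂ] H) ^ t := by
  simp [evolution]

theorem norm_evolution_apply (Q : QuantumWalk d H) (t : ℤ) (ξ : H) :
    ‖Q.evolution t ξ‖ = ‖ξ‖ :=
  ContinuousLinearMap.norm_map_of_mem_unitary (Q.U ^ t).2 ξ

theorem IsIntertwiner.apply_evolution {Q₁ : QuantumWalk d H₁} {Q₂ : QuantumWalk d H₂}
    {T : H₁ →L[ℂ] H₂} (h : IsIntertwiner Q₁ Q₂ T) (t : ℕ) (ξ : H₁) :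
    T (Q₁.evolution t ξ) = Q₂.evolution t (T ξ) := by
  simp only [evolution_natCast]
  induction t with
  | zero => simp
  | succ t ih =>
    rw [pow_succ', pow_succ', mul_apply_eq_comp, mul_apply_eq_comp, ← ih]
    exact congrArg (fun S : H₁ →L[ℂ] H₂ => S _) h

/-- Dilating space by 1/t dilates frequency by 1/t. With the convention 0⁻¹ = 0 this includes `t =
0`. -/
theorem charFun_velocityDist (Q : QuantumWalk d H) (t : ℕ) (ξ : H)
    (k : EuclideanSpace ℝ (Fin d)) :
    charFun (Q.velocityDist t ξ : Measure (EuclideanSpace ℝ (Fin d))) k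
      = charFun (Q.coord.dist (Q.evolution t ξ)) ((t : ℝ)⁻¹ • k) :=
  charFun_map_smul _ _

end QuantumWalk

end QWalk

/-! ### Transfer of weak limits along a uniform intertwiner -/

theorem mainTheorem3 {d : ℕ} {H₁ H₂ : Type*}
    [NormedAddCommGroup H₁] [InnerProductSpace ℂ H₁] [CompleteSpace H₁]
    [NormedAddCommGroup H₂] [InnerProductSpace ℂ H₂] [CompleteSpace H₂]
    (U₁ : QWalk.QuantumWalk d H₁) (U₂ : QWalk.QuantumWalk d H₂)
    (hU₁ : U₁.IsSmooth) (hU₂ : U₂.IsSmooth)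
    (V : H₁ ≃ₗᵢ[ℂ] H₂)
    (hV : U₁.IsIntertwiner U₂ (V.toContinuousLinearEquiv : H₁ →L[ℂ] H₂))
    (hVu : QWalk.IsUniformMorphism U₁.coord U₂.coord (V.toContinuousLinearEquiv : H₁ →L[ℂ] H₂))
    (ξ : H₁)
    (hξ : QWalk.WeaklyConverges fun t : ℕ => U₁.velocityDist t ξ) :
    QWalk.WeaklyConverges fun t : ℕ => U₂.velocityDist t (V ξ) := by
  obtain ⟨ν, hν⟩ := hξ
  refine ⟨ν, QWalk.tendsto_finiteMeasure_of_tendsto_charFun fun k => ?_⟩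
  -- Characters are bounded continuous, but complex valued, so weak convergence is used in its
  -- `RCLike` form.
  have h1 : Tendsto (fun t : ℕ =>
      charFun (U₁.velocityDist t ξ : Measure (EuclideanSpace ℝ (Fin d))) k) atTop
      (𝓝 (charFun (ν : Measure (EuclideanSpace ℝ (Fin d))) k)) := by
    rw [FiniteMeasure.tendsto_iff_forall_integral_rclike_tendsto ℂ] at hν
    simp_rw [charFun_eq_integral_innerProbChar]
    exact hν (BoundedContinuousFunction.innerProbChar k)
  set W : H₁ →L[ℂ] H₂ := (V.toContinuousLinearEquiv : H₁ →L[ℂ] H₂) with hW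
  have h2 : Tendsto (fun t : ℕ =>
      ‖QWalk.conjRep U₁.coord U₂.coord W ((t : ℝ)⁻¹ • k) - W‖ * ‖ξ‖ ^ 2) atTop (𝓝 0) := by
    have hk : Tendsto (fun t : ℕ => (t : ℝ)⁻¹ • k) atTop (𝓝 0) := by
      simpa using (tendsto_inv_atTop_nhds_zero_nat (𝕜 := ℝ)).smul_const k
    have hc : Continuous (QWalk.conjRep U₁.coord U₂.coord W) := hVu
    have := (hc.tendsto 0).comp hk
    rw [QWalk.conjRep_zero] at this
    simpa using ((this.sub_const W).norm).mul_const (‖ξ‖ ^ 2)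
  have h3 : Tendsto (fun t : ℕ =>
      charFun (U₂.velocityDist t (V ξ) : Measure (EuclideanSpace ℝ (Fin d))) k
        - charFun (U₁.velocityDist t ξ : Measure (EuclideanSpace ℝ (Fin d))) k) atTop (𝓝 0) := by
    refine squeeze_zero_norm (fun t => ?_) h2
    have e : U₂.evolution t (V ξ) = V (U₁.evolution t ξ) := (hV.apply_evolution t ξ).symm
    rw [U₂.charFun_velocityDist, U₁.charFun_velocityDist, e]
    refine (QWalk.norm_charFun_dist_sub_le _ _ V _ _).trans_eq ?_
    -- The evolved vector keeps the norm of `ξ`, so the only dependence of the bound on `t` is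
    -- through k/t.
    rw [U₁.norm_evolution_apply]
  simpa using h3.add h1
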